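/- Let $H$ be a complex Hilbert space and $\rho>0$. Let $C_\rho(H)$ be the set of bounded operators $T$ on $H$ admitting a unitary $\rho$-dilation, i.e. for which there are a Hilbert space $\mathcal H$ containing $H$ as a closed subspace and a unitary operator $U$ on $\mathcal H$ with $T^n=\rho\,P_HU^n|_H$ for all $n\ge 1$, where $P_H$ is the orthogonal projection of $\mathcal H$ onto $H$. For $T\in C_\rho(H)$ and $|z|<1$ put $K_z^\rho(T)=(I-\bar zT)^{-1}+(I-zT^*)^{-1}+(\rho-2)I$. For $T_0,T_1\in C_\rho(H)$, say that $T_1$ is Harnack dominated by $T_0$ in $C_\rho(H)$ if there is a constant $c\ge 1$ such that $K_z^\rho(T_1)\le c^2K_z^\rho(T_0)$ for all $|z|<1$ (where $A\le B$ means that $B-A$ is a positive operator), and that $T_0$ and $T_1$ are Harnack equivalent if each is Harnack dominated by the other. An operator $T$ is weakly stable if $\langle T^nx,y\rangle\to 0$ for all $x,y\in H$, and stable if $\|T^nx\|\to 0$ for all $x\in H$, as $n\to\infty$. Let $T_0,T_1\in C_\rho(H)$. (i) If $T_1$ is Harnack dominated by $T_0$ in $C_\rho(H)$ and $T_0$ is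 weakly stable (resp. stable), then $T_1$ is weakly stable (resp. stable). (ii) If $T_0$ and $T_1$ are Harnack equivalent in $C_\rho(H)$, then $T_0$ is weakly stable (resp. stable) if and only if $T_1$ is weakly stable (resp. stable). -/

import Mathlib

open Filter Topology

universe u

section RhoContractions

variable {H : Type u} [NormedAddCommGroup H] [InnerProductSpace ℂ H] [CompleteSpace H]

/-- `T` belongs to the class `C_ρ(H)`: it has a unitary `ρ`-dilation, that is, there are a complex
Hilbert space `K`, an isometric embedding `J` of `H` into `K` and a unitary operator `U` on `K` with
`T ^ n = ρ P_H U ^ n |_H` for all `n ≥ 1`. Under the embedding, `P_H U ^ n |_H` is `J† U ^ n J`. -/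
def IsRhoContraction (ρ : ℝ) (T : H →L[ℂ] H) : Prop :=
  ∃ (K : Type u) (_ : NormedAddCommGroup K) (_ : InnerProductSpace ℂ K) (_ : CompleteSpace K)
    (J : H →ₗᵢ[ℂ] K) (U : K →L[ℂ] K), U ∈ unitary (K →L[ℂ] K) ∧
      ∀ n : ℕ, 1 ≤ n →
        T ^ n = (ρ : ℂ) •
          ((ContinuousLinearMap.adjoint J.toContinuousLinearMap).comp
            ((U ^ n).comp J.toContinuousLinearMap))

/-- The operatorial `ρ`-kernel `(I - z̄ T)⁻¹ + (I - z T*)⁻¹ + (ρ - 2) I`. For `|z| < 1` and `T` a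
`ρ`-contraction, both inverses exist, so that `Ring.inverse` is the actual inverse. -/
noncomputable def rhoKernel (ρ : ℝ) (z : ℂ) (T : H →L[ℂ] H) : H →L[ℂ] H :=
  Ring.inverse (1 - (starRingEnd ℂ z) • T)
    + Ring.inverse (1 - z • ContinuousLinearMap.adjoint T)
    + ((ρ : ℂ) - 2) • (1 : H →L[ℂ] H)

/-- `T₁` is Harnack dominated by `T₀` (in `C_ρ(H)`, for `ρ`-contractions `T₀`, `T₁`):
for some `c ≥ 1`, `K_z^ρ(T₁) ≤ c² K_z^ρ(T₀)` for all `z` in the open unit disc.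
The order on operators is the Loewner order: `A ≤ B` when `B - A` is positive. -/
def HarnackDominated (ρ : ℝ) (T₁ T₀ : H →L[ℂ] H) : Prop :=
  ∃ c : ℝ, 1 ≤ c ∧ ∀ z : ℂ, ‖z‖ < 1 →
    (((c ^ 2 : ℝ) : ℂ) • rhoKernel ρ z T₀ - rhoKernel ρ z T₁).IsPositive

/-- Harnack equivalence: each operator is Harnack dominated by the other. -/
def HarnackEquivalent (ρ : ℝ) (T₁ T₀ : H →L[ℂ] H) : Prop :=
  HarnackDominated ρ T₁ T₀ ∧ HarnackDominated ρ T₀ T₁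

/-- `T` is weakly stable: `T ^ n → 0` in the weak operator topology. -/
def WeaklyStable (T : H →L[ℂ] H) : Prop :=
  ∀ x y : H, Tendsto (fun n : ℕ => inner ℂ ((T ^ n) x) y) atTop (𝓝 0)

/-- `T` is (strongly) stable: `T ^ n → 0` in the strong operator topology. -/
def StronglyStable (T : H →L[ℂ] H) : Prop :=
  ∀ x : H, Tendsto (fun n : ℕ => (T ^ n) x) atTop (𝓝 0)

end RhoContractions

/-! Put `B m = ρ J† Uᵐ J` for `m : ℤ`. The `ρ`-kernel is the Poisson sum of `B`, so Harnack
domination makes the Poisson sums of `c² B₀ - B₁` positive. Pairing with trigonometric polynomials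
and letting `r → 1` turns this into positive Toeplitz forms (`toeplitz_nonneg`), which for `B` are
`ρ` times squared norms. Hence `‖∑ U₁ⁱ J₁ hᵢ‖ ≤ c ‖∑ U₀ⁱ J₀ hᵢ‖`
(`HarnackDominated.exists_norm_sum_le`).

A bounded sequence `w` with `⟪wᵢ, wⱼ⟫ → 0` forces every sequence it dominates to be weakly null
(`tendsto_inner_zero_of_dominated`). Weak stability follows from `wₙ = U₀ⁿ J₀ x`. Stability follows
by passing to adjoints and taking `wₙ = U₀⁻ⁿ J₀ T₁ⁿ x`: the dominated sequence, tested against `J₁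
x`, gives `ρ⁻¹ ‖T₁ⁿ x‖²`. -/

open ContinuousLinearMap in
/-- The two-sided sequence `ρ J† Uᵐ J` of compressed powers of a unitary operator. -/
noncomputable def rhoMoment {H K : Type*} [NormedAddCommGroup H] [InnerProductSpace ℂ H]
    [CompleteSpace H] [NormedAddCommGroup K] [InnerProductSpace ℂ K] [CompleteSpace K]
    (ρ : ℝ) (J : H →ₗᵢ[ℂ] K) (U : unitary (K →L[ℂ] K)) (m : ℤ) : H →L[ℂ] H :=
  (ρ : ℂ) • (adjoint J.toContinuousLinearMap ∘L
    (((U ^ m : unitary (K →L[ℂ] K)) : K →L[ℂ] K) ∘L J.toContinuousLinearMap))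

/-- The Fourier weight `r ^ |m| e ^ (-imθ)`. -/
noncomputable def poissonWeight (r θ : ℝ) (m : ℤ) : ℂ :=
  (r : ℂ) ^ m.natAbs * Complex.exp (-(m * θ * Complex.I))

/-! ### Compressed powers of a unitary -/

section Moments

variable {H K : Type*} [NormedAddCommGroup H] [InnerProductSpace ℂ H] [CompleteSpace H]
  [NormedAddCommGroup K] [InnerProductSpace ℂ K] [CompleteSpace K]
  (ρ : ℝ) (J : H →ₗᵢ[ℂ] K) (U : unitary (K →L[ℂ] K))

open ContinuousLinearMap

theorem inner_rhoMoment (m : ℤ) (x y : H) :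
    inner ℂ x (rhoMoment ρ J U m y)
      = ρ * inner ℂ (J x) (((U ^ m : unitary (K →L[ℂ] K)) : K →L[ℂ] K) (J y)) := by
  simp [rhoMoment, adjoint_inner_right]

theorem norm_rhoMoment_le (m : ℤ) : ‖rhoMoment ρ J U m‖ ≤ |ρ| := by
  refine opNorm_le_bound _ (abs_nonneg _) fun x => ?_
  simp only [rhoMoment, smul_apply, comp_apply, norm_smul, Complex.norm_real, Real.norm_eq_abs]
  gcongr
  have hJ : ‖adjoint J.toContinuousLinearMap‖ ≤ 1 := by
    rw [LinearIsometryEquiv.norm_map]; exact J.norm_toContinuousLinearMap_le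
  refine (le_of_opNorm_le _ hJ _).trans ?_
  rw [one_mul, Unitary.norm_map]
  simp

theorem rhoMoment_zero : rhoMoment ρ J U 0 = (ρ : ℂ) • (1 : H →L[ℂ] H) := by
  ext x
  refine ext_inner_left ℂ fun y => ?_
  rw [inner_rhoMoment, smul_apply, inner_smul_right]
  simp

theorem adjoint_rhoMoment (m : ℤ) : adjoint (rhoMoment ρ J U m) = rhoMoment ρ J U (-m) := by
  ext x
  refine ext_inner_left ℂ fun y => ?_
  rw [adjoint_inner_right, ← inner_conj_symm, inner_rhoMoment, inner_rhoMoment, map_mul,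
    inner_conj_symm, zpow_neg, ← Unitary.star_eq_inv, Unitary.coe_star, star_eq_adjoint,
    adjoint_inner_right]
  simp

end Moments

theorem summable_mul_pow_natAbs (C : ℝ) {r : ℝ} (hr : 0 ≤ r) (hr1 : r < 1) :
    Summable fun m : ℤ => C * r ^ m.natAbs := by
  refine Summable.mul_left _ (Summable.of_nat_of_neg ?_ ?_) <;>
  simpa using summable_geometric_of_lt_one hr hr1

theorem norm_poissonWeight {r : ℝ} (hr : 0 ≤ r) (θ : ℝ) (m : ℤ) :
    ‖poissonWeight r θ m‖ = r ^ m.natAbs := by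
  have : -((m : ℂ) * θ * Complex.I) = ((-(m * θ) : ℝ) : ℂ) * Complex.I := by push_cast; ring
  rw [poissonWeight, this, norm_mul, Complex.norm_exp_ofReal_mul_I]
  simp [abs_of_nonneg hr]

/-- Power-boundedness replaces `‖z • a‖ < 1`, which can fail for `ρ > 1`; the summed series is a
two-sided inverse, so `Ring.inverse` is not its default value. -/
theorem hasSum_smul_pow_ringInverse {A : Type*} [NormedRing A] [CompleteSpace A] [NormedAlgebra ℂ A]
    {a : A} {C : ℝ} (ha : ∀ n, ‖a ^ n‖ ≤ C) {z : ℂ} (hz : ‖z‖ < 1) :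
    HasSum (fun n : ℕ => z ^ n • a ^ n) (Ring.inverse (1 - z • a)) := by
  have hs : Summable fun n : ℕ => (z • a) ^ n := by
    refine Summable.of_norm_bounded (g := fun n => ‖z‖ ^ n * C)
      ((summable_geometric_of_lt_one (norm_nonneg _) hz).mul_right C) fun n => ?_
    rw [smul_pow, norm_smul, norm_pow]
    gcongr
    exact ha n
  have hinv : Ring.inverse (1 - z • a) = ∑' n : ℕ, (z • a) ^ n :=
    Ring.inverse_unit ⟨1 - z • a, _, hs.one_sub_mul_tsum_pow, hs.tsum_pow_mul_one_sub⟩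
  rw [hinv]
  simpa only [smul_pow] using hs.hasSum

/-! ### The kernel as a Poisson sum -/

section Kernel

variable {H K : Type*} [NormedAddCommGroup H] [InnerProductSpace ℂ H] [CompleteSpace H]
  [NormedAddCommGroup K] [InnerProductSpace ℂ K] [CompleteSpace K]
  {ρ : ℝ} {J : H →ₗᵢ[ℂ] K} {U : unitary (K →L[ℂ] K)} {T : H →L[ℂ] H}

open ContinuousLinearMap

theorem norm_pow_le_of_eq_rhoMoment (hT : ∀ n : ℕ, 1 ≤ n → T ^ n = rhoMoment ρ J U n) (n : ℕ) :
    ‖T ^ n‖ ≤ max 1 |ρ| := by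
  rcases Nat.eq_zero_or_pos n with rfl | hn
  · rw [pow_zero]
    exact norm_id_le.trans (le_max_left _ _)
  · exact (hT n hn ▸ norm_rhoMoment_le ρ J U n).trans (le_max_right _ _)

/-- The `ρ`-kernel is the Poisson sum of the compressed powers of the unitary `ρ`-dilation. -/
theorem hasSum_rhoKernel (hT : ∀ n : ℕ, 1 ≤ n → T ^ n = rhoMoment ρ J U n)
    {r : ℝ} (hr : 0 ≤ r) (hr1 : r < 1) (θ : ℝ) :
    HasSum (fun m : ℤ => poissonWeight r θ m • rhoMoment ρ J U m)
      (rhoKernel ρ (r * Complex.exp (θ * Complex.I)) T) := by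
  set z : ℂ := r * Complex.exp (θ * Complex.I) with hz
  have hzn : ‖z‖ < 1 := by
    rw [hz, norm_mul, Complex.norm_exp_ofReal_mul_I]; simpa [abs_of_nonneg hr]
  have hpow := norm_pow_le_of_eq_rhoMoment hT
  have h1 := hasSum_smul_pow_ringInverse hpow (z := (starRingEnd ℂ) z) (by simpa using hzn)
  have h2 := hasSum_smul_pow_ringInverse (a := adjoint T) (C := max 1 |ρ|) (z := z)
    (fun n => by
      rw [← star_eq_adjoint, ← star_pow, norm_star]; exact hpow n) hzn
  -- Adding `ρ - 1` corrects the zeroth term `I` of each half to `B 0 = ρ I`. Gluing the halves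
  -- counts `B 0` twice and subtracts it once, leaving the `ρ - 2` of the kernel.
  have h1' := h1.add (hasSum_ite_eq (0 : ℕ) (((ρ : ℂ) - 1) • (1 : H →L[ℂ] H)))
  have h2' := h2.add (hasSum_ite_eq (0 : ℕ) (((ρ : ℂ) - 1) • (1 : H →L[ℂ] H)))
  have key := HasSum.of_nat_of_neg (f := fun m : ℤ => poissonWeight r θ m • rhoMoment ρ J U m)
    (h1'.congr_fun ?_) (h2'.congr_fun ?_)
  · have hsum : rhoKernel ρ z T = Ring.inverse (1 - (starRingEnd ℂ) z • T)
        + ((ρ : ℂ) - 1) • 1 + (Ring.inverse (1 - z • adjoint T) + ((ρ : ℂ) - 1) • 1)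
        - poissonWeight r θ 0 • rhoMoment ρ J U 0 := by
      have h0 : poissonWeight r θ 0 = 1 := by simp [poissonWeight]
      rw [rhoKernel, rhoMoment_zero, h0]
      module
    rw [hsum]
    exact key
  · intro n
    rcases Nat.eq_zero_or_pos n with rfl | hn
    · simp [poissonWeight, rhoMoment_zero, sub_smul]
    · rw [hT n hn, if_neg hn.ne', add_zero]
      congr 1
      rw [hz, map_mul, mul_pow, ← Complex.exp_conj, ← Complex.exp_nat_mul]
      simp [poissonWeight]
      left; congr 1; ring
  · intro n
    rcases Nat.eq_zero_or_pos n with rfl | hn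
    · simp [poissonWeight, rhoMoment_zero, sub_smul]
    · rw [if_neg hn.ne', add_zero, ← star_eq_adjoint, ← star_pow, hT n hn, star_eq_adjoint,
        adjoint_rhoMoment]
      congr 1
      rw [hz, mul_pow, ← Complex.exp_nat_mul]
      simp [poissonWeight]
      left; congr 1; ring

end Kernel

theorem integral_exp_int_mul (k : ℤ) :
    ∫ θ in (0 : ℝ)..2 * Real.pi, Complex.exp (k * θ * Complex.I)
      = if k = 0 then (2 * Real.pi : ℂ) else 0 := by
  split_ifs with hk
  · simp [hk]
  · have hc : (k : ℂ) * Complex.I ≠ 0 := mul_ne_zero (by exact_mod_cast hk) Complex.I_ne_zero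
    have := integral_exp_mul_complex (a := 0) (b := 2 * Real.pi) hc
    calc _ = ∫ θ in (0 : ℝ)..2 * Real.pi, Complex.exp (k * Complex.I * θ) := by
          congr 1; ext θ; congr 1; ring
      _ = 0 := by
          rw [this]
          have : (k : ℂ) * Complex.I * ((2 * Real.pi : ℝ) : ℂ) = k * (2 * Real.pi * Complex.I) := by
            push_cast; ring
          rw [this, Complex.exp_int_mul_two_pi_mul_I]
          simp

/-! ### From positive Poisson sums to positive Toeplitz forms -/

section Toeplitz

variable {H : Type*} [NormedAddCommGroup H] [InnerProductSpace ℂ H]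

theorem norm_trigPolynomial_le (s : Finset ℕ) (h : ℕ → H) (θ : ℝ) :
    ‖∑ j ∈ s, Complex.exp (j * θ * Complex.I) • h j‖ ≤ ∑ j ∈ s, ‖h j‖ := by
  refine norm_sum_le_of_le _ fun j _ => ?_
  have : (j : ℂ) * θ * Complex.I = ((j * θ : ℝ) : ℂ) * Complex.I := by push_cast; ring
  rw [norm_smul, this, Complex.norm_exp_ofReal_mul_I, one_mul]

theorem poissonWeight_mul_inner_trigPolynomial (B : H →L[ℂ] H) (s : Finset ℕ) (h : ℕ → H)
    (r θ : ℝ) (m : ℤ) :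
    poissonWeight r θ m * inner ℂ (∑ j ∈ s, Complex.exp (j * θ * Complex.I) • h j)
        (B (∑ j ∈ s, Complex.exp (j * θ * Complex.I) • h j))
      = ∑ i ∈ s, ∑ j ∈ s, ((r : ℂ) ^ m.natAbs * inner ℂ (h i) (B (h j)))
          * Complex.exp (((j - i - m : ℤ) : ℂ) * θ * Complex.I) := by
  rw [sum_inner, Finset.mul_sum]
  refine Finset.sum_congr rfl fun i _ => ?_
  rw [map_sum, inner_sum, Finset.mul_sum]
  refine Finset.sum_congr rfl fun j _ => ?_
  have : (((j - i - m : ℤ) : ℂ) * θ * Complex.I)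
      = -(m * θ * Complex.I) + -(i * θ * Complex.I) + j * θ * Complex.I := by push_cast; ring
  rw [map_smul, inner_smul_left, inner_smul_right, ← Complex.exp_conj, poissonWeight, this,
    Complex.exp_add, Complex.exp_add]
  simp only [map_mul, Complex.conj_I, Complex.conj_ofReal, map_natCast, mul_neg]
  ring

/-- With `v θ = ∑ e^(ijθ) hⱼ`, integrating `⟪v, D v⟫ ≥ 0` over the circle keeps exactly the terms `m
= j - i`. -/
theorem toeplitz_poisson_nonneg {B : ℤ → H →L[ℂ] H} {C : ℝ} (hB : ∀ m, ‖B m‖ ≤ C)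
    {r : ℝ} (hr : 0 ≤ r) (hr1 : r < 1)
    (hpos : ∀ θ : ℝ, ∃ D : H →L[ℂ] H, D.IsPositive ∧
      HasSum (fun m : ℤ => poissonWeight r θ m • B m) D) (s : Finset ℕ) (h : ℕ → H) :
    0 ≤ (∑ i ∈ s, ∑ j ∈ s, (r : ℂ) ^ ((j : ℤ) - i).natAbs
      * inner ℂ (h i) (B ((j : ℤ) - i) (h j))).re := by
  choose D hD hsum using hpos
  have hC : 0 ≤ C := (norm_nonneg _).trans (hB 0)
  set v : ℝ → H := fun θ => ∑ j ∈ s, Complex.exp (j * θ * Complex.I) • h j with hv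
  set S : ℝ := ∑ j ∈ s, ‖h j‖
  have hvc : Continuous v := by fun_prop
  have hint := intervalIntegral.hasSum_integral_of_dominated_convergence
    (a := 0) (b := 2 * Real.pi) (μ := MeasureTheory.volume)
    (F := fun m θ => poissonWeight r θ m * inner ℂ (v θ) (B m (v θ)))
    (f := fun θ => inner ℂ (v θ) (D θ (v θ)))
    (fun m _ => (S * (C * S)) * r ^ m.natAbs)
    (fun m => by
      refine Continuous.aestronglyMeasurable ?_
      unfold poissonWeight
      fun_prop)
    (fun m => .of_forall fun θ _ => by
      have hvS : ‖v θ‖ ≤ S := norm_trigPolynomial_le s h θ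
      rw [norm_mul, norm_poissonWeight hr, mul_comm]
      gcongr
      refine (norm_inner_le_norm _ _).trans ?_
      gcongr
      exact ((B m).le_of_opNorm_le (hB m) _).trans (by gcongr))
    (.of_forall fun θ _ => summable_mul_pow_natAbs _ hr hr1)
    (by simp)
    (.of_forall fun θ _ => by
      have := (((hsum θ).mapL (ContinuousLinearMap.apply ℂ H (v θ))).mapL
        (innerSL ℂ (v θ)))
      simpa [inner_smul_right] using this)
  have hterm : ∀ m : ℤ, (∫ θ in (0 : ℝ)..2 * Real.pi,
      poissonWeight r θ m * inner ℂ (v θ) (B m (v θ)))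
      = ∑ i ∈ s, ∑ j ∈ s, if m = (j : ℤ) - i then
          (2 * Real.pi) * ((r : ℂ) ^ m.natAbs * inner ℂ (h i) (B m (h j))) else 0 := by
    intro m
    simp only [hv, poissonWeight_mul_inner_trigPolynomial]
    rw [intervalIntegral.integral_finsetSum fun i _ => Continuous.intervalIntegrable
      (by fun_prop) _ _]
    refine Finset.sum_congr rfl fun i _ => ?_
    rw [intervalIntegral.integral_finsetSum fun j _ => Continuous.intervalIntegrable
      (by fun_prop) _ _]
    refine Finset.sum_congr rfl fun j _ => ?_
    rw [intervalIntegral.integral_const_mul, integral_exp_int_mul]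
    by_cases hm : m = (j : ℤ) - i
    · rw [if_pos (by omega), if_pos hm, mul_comm]
    · rw [if_neg (by omega), if_neg hm, mul_zero]
  have hsum2 : HasSum (fun m : ℤ => ∑ i ∈ s, ∑ j ∈ s, if m = (j : ℤ) - i then
          (2 * Real.pi) * ((r : ℂ) ^ m.natAbs * inner ℂ (h i) (B m (h j))) else 0)
      (∑ i ∈ s, ∑ j ∈ s, (2 * Real.pi) * ((r : ℂ) ^ ((j : ℤ) - i).natAbs
        * inner ℂ (h i) (B ((j : ℤ) - i) (h j)))) := by
    refine hasSum_sum fun i _ => hasSum_sum fun j _ => ?_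
    convert hasSum_single ((j : ℤ) - i) ?_ using 1
    · simp
    · intro m hm
      simp [hm]
  simp only [hterm] at hint
  have heq := hint.unique hsum2
  have hre : ∀ θ, (inner ℂ (v θ) (D θ (v θ)) : ℂ) = ((inner ℂ (v θ) (D θ (v θ)) : ℂ).re : ℂ) ∧
      0 ≤ (inner ℂ (v θ) (D θ (v θ)) : ℂ).re := fun θ => by
    have := (hD θ).inner_nonneg_right (v θ)
    rw [Complex.nonneg_iff] at this
    exact ⟨Complex.ext rfl (by simpa using this.2.symm), this.1⟩
  rw [intervalIntegral.integral_congr fun θ _ => (hre θ).1, intervalIntegral.integral_ofReal]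
    at heq
  simp only [← Finset.mul_sum] at heq
  have hnn : 0 ≤ ∫ θ in (0 : ℝ)..2 * Real.pi, (inner ℂ (v θ) (D θ (v θ)) : ℂ).re :=
    intervalIntegral.integral_nonneg (by positivity) fun θ _ => (hre θ).2
  have hre2 := congrArg Complex.re heq
  have h2pi : (2 * (Real.pi : ℂ)) = ((2 * Real.pi : ℝ) : ℂ) := by push_cast; ring
  rw [h2pi, Complex.re_ofReal_mul, Complex.ofReal_re] at hre2
  rw [hre2] at hnn
  exact nonneg_of_mul_nonneg_right hnn (by positivity)

/-- A bounded operator sequence whose Poisson sums are positive in the open disc has positive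
Toeplitz forms. -/
theorem toeplitz_nonneg {B : ℤ → H →L[ℂ] H} {C : ℝ} (hB : ∀ m, ‖B m‖ ≤ C)
    (hpos : ∀ r : ℝ, 0 ≤ r → r < 1 → ∀ θ : ℝ, ∃ D : H →L[ℂ] H, D.IsPositive ∧
      HasSum (fun m : ℤ => poissonWeight r θ m • B m) D) (s : Finset ℕ) (h : ℕ → H) :
    0 ≤ (∑ i ∈ s, ∑ j ∈ s, inner ℂ (h i) (B ((j : ℤ) - i) (h j))).re := by
  have hc : Continuous fun r : ℝ => (∑ i ∈ s, ∑ j ∈ s, (r : ℂ) ^ ((j : ℤ) - i).natAbs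
      * inner ℂ (h i) (B ((j : ℤ) - i) (h j))).re := by fun_prop
  have ht := (hc.tendsto 1).mono_left (nhdsWithin_le_nhds (s := Set.Iio 1))
  simp only [Complex.ofReal_one, one_pow, one_mul] at ht
  refine ge_of_tendsto ht ?_
  filter_upwards [Ioo_mem_nhdsLT (zero_lt_one (α := ℝ))] with r hr
  exact toeplitz_poisson_nonneg hB hr.1.le hr.2 (hpos r hr.1.le hr.2) s h

end Toeplitz

/-! ### Weak convergence from almost orthogonality -/

section WeakNull

variable {E F : Type*} [NormedAddCommGroup E] [InnerProductSpace ℂ E]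
  [NormedAddCommGroup F] [InnerProductSpace ℂ F]

/-- Greedy choice: each new index is taken beyond all earlier ones, far enough out to be nearly
orthogonal to them. -/
theorem exists_finset_almost_orthogonal {w : ℕ → E}
    (hw : ∀ i, Tendsto (fun j => inner ℂ (w i) (w j)) atTop (𝓝 0)) {p : ℕ → Prop}
    (hp : ∃ᶠ n in atTop, p n) {η : ℝ} (hη : 0 < η) (N : ℕ) :
    ∃ s : Finset ℕ, s.card = N ∧ (∀ n ∈ s, p n) ∧
      ∀ i ∈ s, ∀ j ∈ s, i ≠ j → ‖inner ℂ (w i) (w j)‖ ≤ η := by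
  induction N with
  | zero => exact ⟨∅, by simp⟩
  | succ N ih =>
    obtain ⟨s, hcard, hps, hs⟩ := ih
    have h1 : ∀ᶠ j in atTop, ∀ i ∈ s, ‖inner ℂ (w i) (w j)‖ ≤ η := by
      rw [Finset.eventually_all]
      intro i _
      have := (hw i).norm
      rw [norm_zero] at this
      exact (this.eventually_lt_const hη).mono fun _ h => h.le
    have h2 : ∀ᶠ j in atTop, ∀ i ∈ s, i < j := by
      rw [Finset.eventually_all]
      exact fun i _ => eventually_gt_atTop i
    obtain ⟨k, hpk, hk1, hk2⟩ := (hp.and_eventually (h1.and h2)).exists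
    have hks : k ∉ s := fun h => lt_irrefl _ (hk2 k h)
    refine ⟨insert k s, by rw [Finset.card_insert_of_notMem hks, hcard], ?_, ?_⟩
    · simpa using ⟨hpk, hps⟩
    · intro i hi j hj hij
      rcases Finset.mem_insert.1 hi with rfl | hi' <;>
        rcases Finset.mem_insert.1 hj with rfl | hj'
      · exact absurd rfl hij
      · rw [norm_inner_symm]; exact hk1 j hj'
      · exact hk1 i hi'
      · exact hs i hi' j hj' hij

theorem norm_sum_sq_le_of_almost_orthogonal {w : ℕ → E} {M η : ℝ} (hM : ∀ n, ‖w n‖ ≤ M)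
    (s : Finset ℕ) (hη : 0 ≤ η)
    (hs : ∀ i ∈ s, ∀ j ∈ s, i ≠ j → ‖inner ℂ (w i) (w j)‖ ≤ η) {a : ℕ → ℂ} (ha : ∀ n, ‖a n‖ ≤ 1) :
    ‖∑ n ∈ s, a n • w n‖ ^ 2 ≤ s.card * (M ^ 2 + s.card * η) := by
  have hbound : ∀ i ∈ s, ∀ j ∈ s,
      ‖inner ℂ (a i • w i) (a j • w j)‖ ≤ (if i = j then M ^ 2 else 0) + η := by
    intro i hi j hj
    have h1 : ‖inner ℂ (a i • w i) (a j • w j)‖ ≤ ‖inner ℂ (w i) (w j)‖ := by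
      rw [inner_smul_left, inner_smul_right, norm_mul, norm_mul, RCLike.norm_conj, ← mul_assoc]
      exact mul_le_of_le_one_left (norm_nonneg _)
        (mul_le_one₀ (ha i) (norm_nonneg _) (ha j))
    refine h1.trans ?_
    split_ifs with hij
    · subst hij
      refine (norm_inner_le_norm _ _).trans ?_
      nlinarith [hM i, norm_nonneg (w i)]
    · simpa using hs i hi j hj hij
  calc ‖∑ n ∈ s, a n • w n‖ ^ 2
      = ‖inner ℂ (∑ n ∈ s, a n • w n) (∑ n ∈ s, a n • w n)‖ := by
        rw [inner_self_eq_norm_sq_to_K]; simp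
    _ ≤ ∑ i ∈ s, ∑ j ∈ s, ((if i = j then M ^ 2 else 0) + η) := by
        rw [sum_inner]
        refine norm_sum_le_of_le _ fun i hi => ?_
        rw [inner_sum]
        exact norm_sum_le_of_le _ fun j hj => hbound i hi j hj
    _ = s.card * (M ^ 2 + s.card * η) := by
        simp [Finset.sum_add_distrib]
        ring

/-- If `w` is bounded, `⟪wᵢ, wⱼ⟫ → 0` as `j → ∞` for each `i`, and `wₙ ↦ gₙ` extends to a bounded
linear map on the span of `w`, then `g` tends weakly to zero. -/
theorem tendsto_inner_zero_of_dominated {w : ℕ → E} {g : ℕ → F} {c M : ℝ}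
    (hdom : ∀ (s : Finset ℕ) (a : ℕ → ℂ), ‖∑ n ∈ s, a n • g n‖ ≤ c * ‖∑ n ∈ s, a n • w n‖)
    (hM : ∀ n, ‖w n‖ ≤ M) (hw : ∀ i, Tendsto (fun j => inner ℂ (w i) (w j)) atTop (𝓝 0)) (y : F) :
    Tendsto (fun n => inner ℂ y (g n)) atTop (𝓝 0) := by
  rw [Metric.tendsto_nhds]
  by_contra! hcon
  obtain ⟨ε, hε, hfreq⟩ := hcon
  have hp : ∃ᶠ n in atTop, ε ≤ ‖inner ℂ y (g n)‖ := by
    refine hfreq.mono fun n hn => ?_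
    simpa using hn
  -- The signed sum of `N` terms pairs with `y` to at least `N ε`, while domination allows only
  -- order `√N`; this `N` makes the two incompatible.
  obtain ⟨N, hN⟩ := exists_nat_gt ((‖y‖ * c) ^ 2 * (M ^ 2 + 1) / ε ^ 2)
  have hNpos : (0 : ℝ) < N := lt_of_le_of_lt (by positivity) hN
  obtain ⟨s, hcard, hps, hs⟩ :=
    exists_finset_almost_orthogonal hw hp (η := 1 / N) (by positivity) N
  -- Phases that align the inner products on the positive axis; `0 / 0 = 0` covers vanishing ones.
  set a : ℕ → ℂ := fun n => (starRingEnd ℂ) (inner ℂ y (g n)) / ‖inner ℂ y (g n)‖ with ha_def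
  have ha : ∀ n, ‖a n‖ ≤ 1 := fun n => by
    simp only [ha_def, norm_div, RCLike.norm_conj, Complex.norm_real, norm_norm]
    exact div_self_le_one _
  have hw2 := norm_sum_sq_le_of_almost_orthogonal hM s (by positivity) hs ha
  rw [hcard, mul_one_div_cancel hNpos.ne'] at hw2
  have hsum : inner ℂ y (∑ n ∈ s, a n • g n) = ((∑ n ∈ s, ‖inner ℂ y (g n)‖ : ℝ) : ℂ) := by
    rw [inner_sum, Complex.ofReal_sum]
    refine Finset.sum_congr rfl fun n _ => ?_
    rw [inner_smul_right, ha_def]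
    by_cases h0 : inner ℂ y (g n) = (0 : ℂ)
    · simp [h0]
    · have : (‖inner ℂ y (g n)‖ : ℂ) ≠ 0 := by simpa using h0
      rw [div_mul_eq_mul_div, Complex.conj_mul', sq, mul_div_assoc, div_self this, mul_one]
  have hlow : N * ε ≤ ‖y‖ * c * ‖∑ n ∈ s, a n • w n‖ := by
    calc N * ε = ∑ n ∈ s, ε := by simp [hcard]
      _ ≤ ∑ n ∈ s, ‖inner ℂ y (g n)‖ := Finset.sum_le_sum hps
      _ = ‖inner ℂ y (∑ n ∈ s, a n • g n)‖ := by
          rw [hsum, Complex.norm_real, Real.norm_of_nonneg (Finset.sum_nonneg fun _ _ => norm_nonneg _)]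
      _ ≤ ‖y‖ * ‖∑ n ∈ s, a n • g n‖ := norm_inner_le_norm _ _
      _ ≤ ‖y‖ * c * ‖∑ n ∈ s, a n • w n‖ := by
          rw [mul_assoc]; gcongr; exact hdom s a
  have hsq : (N * ε) ^ 2 ≤ (‖y‖ * c) ^ 2 * (N * (M ^ 2 + 1)) := by
    calc (N * ε) ^ 2 ≤ (‖y‖ * c * ‖∑ n ∈ s, a n • w n‖) ^ 2 := by gcongr
      _ = (‖y‖ * c) ^ 2 * ‖∑ n ∈ s, a n • w n‖ ^ 2 := mul_pow _ _ _
      _ ≤ _ := by gcongr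
  rw [div_lt_iff₀ (by positivity)] at hN
  nlinarith

end WeakNull

/-! ### Domination between the dilations -/

section Domination

variable {H K K₀ K₁ : Type*} [NormedAddCommGroup H] [InnerProductSpace ℂ H] [CompleteSpace H]
  [NormedAddCommGroup K] [InnerProductSpace ℂ K] [CompleteSpace K]
  [NormedAddCommGroup K₀] [InnerProductSpace ℂ K₀] [CompleteSpace K₀]
  [NormedAddCommGroup K₁] [InnerProductSpace ℂ K₁] [CompleteSpace K₁]

theorem unitary_inner_pow_pow (U : unitary (K →L[ℂ] K)) (i j : ℕ) (x y : K) :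
    inner ℂ (((U : K →L[ℂ] K) ^ i) x) (((U : K →L[ℂ] K) ^ j) y)
      = inner ℂ x (((U ^ ((j : ℤ) - i) : unitary (K →L[ℂ] K)) : K →L[ℂ] K) y) := by
  have hj : (U : K →L[ℂ] K) ^ j
      = (U : K →L[ℂ] K) ^ i * ((U ^ ((j : ℤ) - i) : unitary (K →L[ℂ] K)) : K →L[ℂ] K) := by
    have : U ^ j = U ^ i * U ^ ((j : ℤ) - i) := by
      rw [← zpow_natCast, ← zpow_natCast, ← zpow_add]; congr 1; ring
    simpa using congrArg (fun V : unitary (K →L[ℂ] K) => (V : K →L[ℂ] K)) this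
  rw [hj, mul_apply_eq_comp]
  simpa using Unitary.inner_map_map (U ^ i) x _

theorem sum_inner_rhoMoment (ρ : ℝ) (J : H →ₗᵢ[ℂ] K) (U : unitary (K →L[ℂ] K))
    (s : Finset ℕ) (h : ℕ → H) :
    ∑ i ∈ s, ∑ j ∈ s, inner ℂ (h i) (rhoMoment ρ J U ((j : ℤ) - i) (h j))
      = ((ρ * ‖∑ i ∈ s, ((U : K →L[ℂ] K) ^ i) (J (h i))‖ ^ 2 : ℝ) : ℂ) := by
  have : ((‖∑ i ∈ s, ((U : K →L[ℂ] K) ^ i) (J (h i))‖ ^ 2 : ℝ) : ℂ)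
      = inner ℂ (∑ i ∈ s, ((U : K →L[ℂ] K) ^ i) (J (h i)))
        (∑ i ∈ s, ((U : K →L[ℂ] K) ^ i) (J (h i))) := by
    rw [inner_self_eq_norm_sq_to_K]; simp
  rw [Complex.ofReal_mul, this, sum_inner, Finset.mul_sum]
  refine Finset.sum_congr rfl fun i _ => ?_
  rw [inner_sum, Finset.mul_sum]
  refine Finset.sum_congr rfl fun j _ => ?_
  rw [inner_rhoMoment, unitary_inner_pow_pow]

/-- Harnack domination passes to the unitary `ρ`-dilations. -/
theorem HarnackDominated.exists_norm_sum_le {ρ : ℝ} (hρ : 0 < ρ) {T₀ T₁ : H →L[ℂ] H}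
    {J₀ : H →ₗᵢ[ℂ] K₀} {U₀ : unitary (K₀ →L[ℂ] K₀)} {J₁ : H →ₗᵢ[ℂ] K₁} {U₁ : unitary (K₁ →L[ℂ] K₁)}
    (hT₀ : ∀ n : ℕ, 1 ≤ n → T₀ ^ n = rhoMoment ρ J₀ U₀ n)
    (hT₁ : ∀ n : ℕ, 1 ≤ n → T₁ ^ n = rhoMoment ρ J₁ U₁ n) (hd : HarnackDominated ρ T₁ T₀) :
    ∃ c : ℝ, ∀ (s : Finset ℕ) (h : ℕ → H),
      ‖∑ i ∈ s, ((U₁ : K₁ →L[ℂ] K₁) ^ i) (J₁ (h i))‖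
        ≤ c * ‖∑ i ∈ s, ((U₀ : K₀ →L[ℂ] K₀) ^ i) (J₀ (h i))‖ := by
  obtain ⟨c, hc, hpos⟩ := hd
  refine ⟨c, fun s h => ?_⟩
  have key := toeplitz_nonneg
    (B := fun m => ((c ^ 2 : ℝ) : ℂ) • rhoMoment ρ J₀ U₀ m - rhoMoment ρ J₁ U₁ m)
    (C := c ^ 2 * |ρ| + |ρ|)
    (fun m => by
      refine (norm_sub_le _ _).trans ?_
      rw [norm_smul, Complex.norm_real, Real.norm_of_nonneg (sq_nonneg c)]
      gcongr <;> exact norm_rhoMoment_le ..)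
    (fun r hr hr1 θ => by
      refine ⟨_, hpos (r * Complex.exp (θ * Complex.I)) ?_, ?_⟩
      · rw [norm_mul, Complex.norm_exp_ofReal_mul_I]; simpa [abs_of_nonneg hr]
      · refine (((hasSum_rhoKernel hT₀ hr hr1 θ).const_smul ((c ^ 2 : ℝ) : ℂ)).sub
          (hasSum_rhoKernel hT₁ hr hr1 θ)).congr_fun fun m => ?_
        module) s h
  simp only [sub_apply, smul_apply, inner_sub_right,
    inner_smul_right, Finset.sum_sub_distrib, ← Finset.mul_sum, sum_inner_rhoMoment] at key
  rw [← Complex.ofReal_mul, ← Complex.ofReal_sub, Complex.ofReal_re, sub_nonneg,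
    mul_left_comm, mul_le_mul_iff_right₀ hρ, ← mul_pow] at key
  exact le_of_sq_le_sq key (by positivity)

end Domination

/-! ### Transfer of stability -/

section Stability

variable {H K K₀ K₁ : Type*} [NormedAddCommGroup H] [InnerProductSpace ℂ H] [CompleteSpace H]
  [NormedAddCommGroup K] [InnerProductSpace ℂ K] [CompleteSpace K]
  [NormedAddCommGroup K₀] [InnerProductSpace ℂ K₀] [CompleteSpace K₀]
  [NormedAddCommGroup K₁] [InnerProductSpace ℂ K₁] [CompleteSpace K₁]
  {ρ : ℝ}

open ContinuousLinearMap

theorem adjoint_pow_eq_rhoMoment {T : H →L[ℂ] H} {J : H →ₗᵢ[ℂ] K} {U : unitary (K →L[ℂ] K)}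
    (hT : ∀ n : ℕ, 1 ≤ n → T ^ n = rhoMoment ρ J U n) (n : ℕ) (hn : 1 ≤ n) :
    adjoint T ^ n = rhoMoment ρ J U⁻¹ n := by
  rw [← star_eq_adjoint, ← star_pow, hT n hn, star_eq_adjoint, adjoint_rhoMoment, rhoMoment,
    rhoMoment, inv_zpow']

/-- Strictness of `i < j` matters: the zeroth moment is `ρ I`, not `T ^ 0`. -/
theorem inner_dilation_pow (hρ : 0 < ρ) {T : H →L[ℂ] H} {J : H →ₗᵢ[ℂ] K}
    {U : unitary (K →L[ℂ] K)} (hT : ∀ n : ℕ, 1 ≤ n → T ^ n = rhoMoment ρ J U n)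
    {i j : ℕ} (hij : i < j) (x y : H) :
    inner ℂ (((U : K →L[ℂ] K) ^ i) (J x)) (((U : K →L[ℂ] K) ^ j) (J y))
      = (ρ : ℂ)⁻¹ * inner ℂ x ((T ^ (j - i)) y) := by
  have hρ' : (ρ : ℂ) ≠ 0 := by exact_mod_cast hρ.ne'
  rw [hT (j - i) (by omega), inner_rhoMoment, inv_mul_cancel_left₀ hρ', unitary_inner_pow_pow,
    Nat.cast_sub hij.le]

theorem rhoKernel_adjoint (ρ : ℝ) (z : ℂ) (T : H →L[ℂ] H) :
    rhoKernel ρ z (adjoint T) = rhoKernel ρ ((starRingEnd ℂ) z) T := by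
  simp only [rhoKernel, adjoint_adjoint, Complex.conj_conj]
  abel

theorem HarnackDominated.adjoint {T₀ T₁ : H →L[ℂ] H} (hd : HarnackDominated ρ T₁ T₀) :
    HarnackDominated ρ (adjoint T₁) (adjoint T₀) := by
  obtain ⟨c, hc, hpos⟩ := hd
  refine ⟨c, hc, fun z hz => ?_⟩
  rw [rhoKernel_adjoint, rhoKernel_adjoint]
  exact hpos _ (by simpa using hz)

theorem HarnackDominated.weaklyStable_of_dilation (hρ : 0 < ρ) {T₀ T₁ : H →L[ℂ] H}
    {J₀ : H →ₗᵢ[ℂ] K₀} {U₀ : unitary (K₀ →L[ℂ] K₀)} {J₁ : H →ₗᵢ[ℂ] K₁} {U₁ : unitary (K₁ →L[ℂ] K₁)}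
    (hT₀ : ∀ n : ℕ, 1 ≤ n → T₀ ^ n = rhoMoment ρ J₀ U₀ n)
    (hT₁ : ∀ n : ℕ, 1 ≤ n → T₁ ^ n = rhoMoment ρ J₁ U₁ n) (hd : HarnackDominated ρ T₁ T₀)
    (hs : WeaklyStable T₀) : WeaklyStable T₁ := by
  intro x y
  obtain ⟨c, hc⟩ := hd.exists_norm_sum_le hρ hT₀ hT₁
  have hg := tendsto_inner_zero_of_dominated
    (w := fun n => ((U₀ : K₀ →L[ℂ] K₀) ^ n) (J₀ x)) (g := fun n => ((U₁ : K₁ →L[ℂ] K₁) ^ n) (J₁ x))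
    (c := c) (M := ‖x‖) (fun s a => by simpa using hc s fun n => a n • x)
    (fun n => by simpa using (Unitary.norm_map (U₀ ^ n) (J₀ x)).le)
    (fun i => by
      have h0 : Tendsto (fun j => (ρ : ℂ)⁻¹ * inner ℂ x ((T₀ ^ (j - i)) x)) atTop (𝓝 0) := by
        have := ((hs x x).comp (tendsto_sub_atTop_nat i)).star.const_mul ((ρ : ℂ)⁻¹)
        simpa using this
      refine h0.congr' ?_
      filter_upwards [eventually_gt_atTop i] with j hj
      exact (inner_dilation_pow hρ hT₀ hj x x).symm) (J₁ y)
  have h1 := (hg.const_mul (ρ : ℂ)).star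
  rw [mul_zero, star_zero] at h1
  refine h1.congr' ?_
  filter_upwards [eventually_ge_atTop 1] with n hn
  rw [← inner_conj_symm ((T₁ ^ n) x) y, hT₁ n hn, inner_rhoMoment]
  simp

theorem HarnackDominated.stronglyStable_of_dilation (hρ : 0 < ρ) {T₀ T₁ : H →L[ℂ] H}
    {J₀ : H →ₗᵢ[ℂ] K₀} {U₀ : unitary (K₀ →L[ℂ] K₀)} {J₁ : H →ₗᵢ[ℂ] K₁} {U₁ : unitary (K₁ →L[ℂ] K₁)}
    (hT₀ : ∀ n : ℕ, 1 ≤ n → T₀ ^ n = rhoMoment ρ J₀ U₀ n)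
    (hT₁ : ∀ n : ℕ, 1 ≤ n → T₁ ^ n = rhoMoment ρ J₁ U₁ n) (hd : HarnackDominated ρ T₁ T₀)
    (hs : StronglyStable T₀) : StronglyStable T₁ := by
  intro x
  have hT₀' := adjoint_pow_eq_rhoMoment hT₀
  have hT₁' := adjoint_pow_eq_rhoMoment hT₁
  obtain ⟨c, hc⟩ := hd.adjoint.exists_norm_sum_le hρ hT₀' hT₁'
  set M : ℝ := max 1 |ρ| * ‖x‖
  have hbdd : ∀ n, ‖(T₁ ^ n) x‖ ≤ M := fun n =>
    le_of_opNorm_le _ (norm_pow_le_of_eq_rhoMoment hT₁ n) x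
  have hadj : ∀ (T : H →L[ℂ] H) (n : ℕ) (u v : H),
      inner ℂ u ((ContinuousLinearMap.adjoint T ^ n) v) = inner ℂ ((T ^ n) u) v :=
    fun T n u v => by
      rw [← star_eq_adjoint, ← star_pow, star_eq_adjoint, adjoint_inner_right]
  -- The vectors `T₁ⁿ x` vary with `n`, which the domination inequality permits. For `i < j`, `⟪wᵢ,
  -- wⱼ⟫ = ρ⁻¹ ⟪T₀^(j-i) T₁ⁱ x, T₁ʲ x⟫`, small since `T₀` is stable and `T₁` power-bounded.
  have hg := tendsto_inner_zero_of_dominated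
    (w := fun n => (((U₀⁻¹ : unitary (K₀ →L[ℂ] K₀)) : K₀ →L[ℂ] K₀) ^ n) (J₀ ((T₁ ^ n) x)))
    (g := fun n => (((U₁⁻¹ : unitary (K₁ →L[ℂ] K₁)) : K₁ →L[ℂ] K₁) ^ n) (J₁ ((T₁ ^ n) x)))
    (c := c) (M := M)
    (fun s a => by simpa only [map_smul] using hc s fun n => a n • (T₁ ^ n) x)
    (fun n => by
      have := Unitary.norm_map ((U₀⁻¹) ^ n) (J₀ ((T₁ ^ n) x))
      rw [J₀.norm_map, SubmonoidClass.coe_pow] at this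
      exact this.trans_le (hbdd n))
    (fun i => by
      have h0 : Tendsto (fun j => ρ⁻¹ * (‖(T₀ ^ (j - i)) ((T₁ ^ i) x)‖ * M)) atTop (𝓝 0) := by
        have := ((((hs ((T₁ ^ i) x)).comp (tendsto_sub_atTop_nat i)).norm).mul_const M).const_mul
          (ρ⁻¹)
        simpa using this
      refine squeeze_zero_norm' ?_ h0
      filter_upwards [eventually_gt_atTop i] with j hj
      rw [inner_dilation_pow hρ hT₀' hj, hadj, norm_mul, norm_inv, Complex.norm_real,
        Real.norm_of_nonneg hρ.le]
      gcongr
      exact (norm_inner_le_norm _ _).trans (by gcongr; exact hbdd j)) (J₁ x)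
  have h1 := (hg.const_mul (ρ : ℂ)).norm
  rw [mul_zero, norm_zero] at h1
  have h2 : Tendsto (fun n => ‖(T₁ ^ n) x‖ ^ 2) atTop (𝓝 0) := by
    refine h1.congr' ?_
    filter_upwards [eventually_gt_atTop 0] with n hn
    have h3 := inner_dilation_pow hρ hT₁' hn x ((T₁ ^ n) x)
    rw [pow_zero, one_apply_eq_self, Nat.sub_zero, hadj, inner_self_eq_norm_sq_to_K] at h3
    have hρ' : (ρ : ℂ) ≠ 0 := by exact_mod_cast hρ.ne'
    rw [h3, mul_inv_cancel_left₀ hρ']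
    simp
  rw [tendsto_zero_iff_norm_tendsto_zero]
  simpa [Real.sqrt_sq] using h2.sqrt

end Stability

section RhoContraction

variable {H : Type u} [NormedAddCommGroup H] [InnerProductSpace ℂ H] [CompleteSpace H]

theorem IsRhoContraction.exists_rhoMoment {ρ : ℝ} {T : H →L[ℂ] H} (h : IsRhoContraction ρ T) :
    ∃ (K : Type u) (_ : NormedAddCommGroup K) (_ : InnerProductSpace ℂ K) (_ : CompleteSpace K)
      (J : H →ₗᵢ[ℂ] K) (U : unitary (K →L[ℂ] K)),
      ∀ n : ℕ, 1 ≤ n → T ^ n = rhoMoment ρ J U n := by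
  obtain ⟨K, i1, i2, i3, J, U, hU, hT⟩ := h
  refine ⟨K, i1, i2, i3, J, ⟨U, hU⟩, fun n hn => ?_⟩
  rw [hT n hn, rhoMoment, zpow_natCast, SubmonoidClass.coe_pow]

theorem HarnackDominated.stable {ρ : ℝ} (hρ : 0 < ρ) {T₀ T₁ : H →L[ℂ] H}
    (h₀ : IsRhoContraction ρ T₀) (h₁ : IsRhoContraction ρ T₁) (hd : HarnackDominated ρ T₁ T₀) :
    (WeaklyStable T₀ → WeaklyStable T₁) ∧ (StronglyStable T₀ → StronglyStable T₁) := by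
  obtain ⟨K₀, _, _, _, J₀, U₀, hT₀⟩ := h₀.exists_rhoMoment
  obtain ⟨K₁, _, _, _, J₁, U₁, hT₁⟩ := h₁.exists_rhoMoment
  exact ⟨hd.weaklyStable_of_dilation hρ hT₀ hT₁, hd.stronglyStable_of_dilation hρ hT₀ hT₁⟩

end RhoContraction

theorem corollary2p14 {H : Type u} [NormedAddCommGroup H] [InnerProductSpace ℂ H]
    [CompleteSpace H] (ρ : ℝ) (hρ : 0 < ρ) (T₀ T₁ : H →L[ℂ] H)
    (h₀ : IsRhoContraction ρ T₀) (h₁ : IsRhoContraction ρ T₁) :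
    (HarnackDominated ρ T₁ T₀ →
      (WeaklyStable T₀ → WeaklyStable T₁) ∧ (StronglyStable T₀ → StronglyStable T₁)) ∧
    (HarnackEquivalent ρ T₁ T₀ →
      (WeaklyStable T₀ ↔ WeaklyStable T₁) ∧ (StronglyStable T₀ ↔ StronglyStable T₁)) := by
  refine ⟨fun hd => hd.stable hρ h₀ h₁, fun he => ?_⟩
  have h01 := he.1.stable hρ h₀ h₁
  have h10 := he.2.stable hρ h₁ h₀
  exact ⟨⟨h01.1, h10.1⟩, ⟨h01.2, h10.2⟩⟩
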